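/- All graphs are finite and simple. For a graph $G$ with a subgraph $H$, let $G\setminus H$ denote the graph obtained from $G$ by deleting the edges of $H$ (and keeping all vertices). Two graphs are cospectral if their adjacency matrices have the same spectrum (eigenvalues counted with multiplicity), and a graph $G$ is determined by its (adjacency) spectrum if every graph cospectral with $G$ is isomorphic to $G$. **Theorem.** Let $n, m \ge 0$ be integers with $m\leq n-2$. Then the graph $K_n\setminus K_m$, obtained from the complete graph $K_n$ by deleting the edges of a complete subgraph on $m$ of its vertices, is determined by its adjacency spectrum. -/

import Mathlib

universe u v

namespace SimpleGraph

open Classical in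
/-- The adjacency spectrum of a finite simple graph: the multiset of eigenvalues (with
multiplicities) of its adjacency matrix over the reals. -/
noncomputable def adjSpectrum {V : Type u} [Fintype V] (G : SimpleGraph V) : Multiset ℝ :=
  (G.adjMatrix ℝ).charpoly.roots

/-- Two finite graphs, possibly on different vertex sets, are cospectral if their adjacency
matrices have the same spectrum. -/
def Cospectral {V : Type u} {W : Type v} [Fintype V] [Fintype W]
    (G : SimpleGraph V) (H : SimpleGraph W) : Prop :=
  G.adjSpectrum = H.adjSpectrum

/-- `G` is determined by its adjacency spectrum: every finite graph cospectral with `G` is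
isomorphic with `G`. -/
def IsDeterminedBySpectrum {V : Type u} [Fintype V] (G : SimpleGraph V) : Prop :=
  ∀ (W : Type v) [Fintype W] (G' : SimpleGraph W), Cospectral G' G → Nonempty (G' ≃g G)

/-- The graph `G ∖ H`, obtained from `G` by deleting the edges (but no vertices) of its
subgraph `H`. -/
def deleteSubgraphEdges {V : Type u} (G : SimpleGraph V) (H : G.Subgraph) : SimpleGraph V :=
  G.deleteEdges H.edgeSet

end SimpleGraph

/-! `K_n ∖ K_m` is a complete split graph: a clique `T` of size t joined to an independent set `S`
of size s. Its eigenvalues are -1, 0 and the two roots, of opposite sign, of x² - (t-1)x - ts. So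
one eigenvalue is positive, at most one is below -1, and, as m ≤ n-2, -1 occurs. Conversely, these
features force the shape of a cospectral graph (`exists_isCompleteSplitOn`). One positive eigenvalue
makes it complete multipartite up to isolated vertices; the eigenvalue -1 gives a singleton part; at
most one eigenvalue below -1 leaves at most one larger part. The spectrum then yields t and s
(`IsCompleteSplitOn.ncard_eq`), and the vertex count excludes isolated vertices. -/

open Matrix Polynomial

/-! ### Quadratic forms with at most one positive eigenvalue -/

namespace Matrix

variable {W : Type*} [Fintype W]

/-- A real symmetric matrix all of whose shifted eigenvalues, with one exception, are nonpositive
has a nonpositive quadratic form on a hyperplane. -/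
theorem IsHermitian.exists_dotProduct_eq_zero_imp [DecidableEq W] {A : Matrix W W ℝ}
    (hA : A.IsHermitian) (i₀ : W) (a c : ℝ)
    (h : ∀ i, i ≠ i₀ → a * hA.eigenvalues i + c ≤ 0) :
    ∃ u : W → ℝ, ∀ w : W → ℝ, u ⬝ᵥ w = 0 → w ⬝ᵥ ((a • A + c • (1 : Matrix W W ℝ)) *ᵥ w) ≤ 0 := by
  set e := hA.eigenvectorBasis with he
  refine ⟨⇑(e i₀), fun w hw => ?_⟩
  have hin : ∀ i (x : W → ℝ), inner ℝ (e i) (WithLp.toLp 2 x) = (⇑(e i) : W → ℝ) ⬝ᵥ x := by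
    intro i x
    rw [EuclideanSpace.inner_eq_star_dotProduct, dotProduct_comm]
    simp
  have key : ∀ x : W → ℝ, w ⬝ᵥ x = ∑ i, (⇑(e i) ⬝ᵥ w) * (⇑(e i) ⬝ᵥ x) := by
    intro x
    have := e.sum_inner_mul_inner (WithLp.toLp 2 w) (WithLp.toLp 2 x)
    simp only [hin, real_inner_comm (e _)] at this
    rw [EuclideanSpace.inner_eq_star_dotProduct] at this
    rw [dotProduct_comm w x]
    simpa using this.symm
  have hAe : ∀ i, ⇑(e i) ⬝ᵥ (A *ᵥ w) = hA.eigenvalues i * (⇑(e i) ⬝ᵥ w) := by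
    intro i
    have hT : Aᵀ = A := by simpa [IsHermitian, conjTranspose] using hA
    rw [dotProduct_mulVec, ← mulVec_transpose, hT, hA.mulVec_eigenvectorBasis, smul_dotProduct,
      smul_eq_mul]
  rw [key]
  refine Finset.sum_nonpos fun i _ => ?_
  rw [add_mulVec, smul_mulVec, smul_mulVec, one_mulVec, dotProduct_add, dotProduct_smul,
    dotProduct_smul, hAe, smul_eq_mul, smul_eq_mul]
  by_cases hi : i = i₀
  · subst hi; rw [hw]; simp
  · nlinarith [h i hi, mul_self_nonneg (⇑(e i) ⬝ᵥ w)]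

/-- The reversed Cauchy-Schwarz inequality for a symmetric form that is nonpositive on a
hyperplane. -/
theorem IsSymm.dotProduct_mulVec_mul_le {M : Matrix W W ℝ} (hM : M.IsSymm)
    (h : ∃ u : W → ℝ, ∀ w : W → ℝ, u ⬝ᵥ w = 0 → w ⬝ᵥ (M *ᵥ w) ≤ 0) (x y : W → ℝ)
    (hx : 0 < x ⬝ᵥ (M *ᵥ x)) :
    (x ⬝ᵥ (M *ᵥ x)) * (y ⬝ᵥ (M *ᵥ y)) ≤ (x ⬝ᵥ (M *ᵥ y)) ^ 2 := by
  obtain ⟨u, hu⟩ := h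
  have hsymm : y ⬝ᵥ (M *ᵥ x) = x ⬝ᵥ (M *ᵥ y) := by
    rw [dotProduct_mulVec, ← mulVec_transpose, hM.eq, dotProduct_comm]
  have hne : u ⬝ᵥ x ≠ 0 := fun h0 => absurd (hu x h0) (not_le.2 hx)
  -- The combination of `x` and `y` lying in the hyperplane orthogonal to `u`.
  have := hu ((u ⬝ᵥ y) • x - (u ⬝ᵥ x) • y) (by
    simp only [dotProduct_sub, dotProduct_smul, smul_eq_mul]; ring)
  simp only [mulVec_sub, mulVec_smul, dotProduct_sub, sub_dotProduct, dotProduct_smul,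
    smul_dotProduct, smul_eq_mul, hsymm] at this
  have hpos : 0 < (u ⬝ᵥ x) ^ 2 := by positivity
  set p := u ⬝ᵥ x
  set q := u ⬝ᵥ y
  set X := x ⬝ᵥ (M *ᵥ x)
  set Y := y ⬝ᵥ (M *ᵥ y)
  set B := x ⬝ᵥ (M *ᵥ y)
  have h1 : p ^ 2 * (X * Y) ≤ p ^ 2 * B ^ 2 := by
    nlinarith [mul_le_mul_of_nonneg_left this hx.le, sq_nonneg (q * X - p * B)]
  exact le_of_mul_le_mul_left h1 hpos

open Classical in
/-- If at most one root of the characteristic polynomial satisfies `p`, then all eigenvalues but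
one violate `p`. -/
theorem IsHermitian.exists_forall_ne_not {A : Matrix W W ℝ} [Nonempty W]
    (hA : A.IsHermitian) (p : ℝ → Prop) (h : A.charpoly.roots.countP p ≤ 1) :
    ∃ i₀, ∀ i, i ≠ i₀ → ¬ p (hA.eigenvalues i) := by
  rw [hA.roots_charpoly_eq_eigenvalues, Multiset.countP_map] at h
  by_cases hex : ∃ i₀, p (hA.eigenvalues i₀)
  · obtain ⟨i₀, hi₀⟩ := hex
    refine ⟨i₀, fun i hi hp => hi ?_⟩
    have h' : (Finset.univ.filter fun i => p (hA.eigenvalues i)).card ≤ 1 := h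
    exact Finset.card_le_one.1 h' i (by simpa using hp) i₀ (by simpa using hi₀)
  · push Not at hex
    exact ⟨Classical.arbitrary W, fun i _ => hex i⟩

end Matrix

/-! ### Complete split graphs and their characteristic polynomial -/

namespace SimpleGraph

variable {W : Type*}

/-- Every edge of `G` joins two vertices of `T ∪ S`, at least one of them in `T`, and all such
pairs are edges: `G` is a complete split graph with clique `T` and independent set `S`, together
with isolated vertices. -/
structure IsCompleteSplitOn (G : SimpleGraph W) (T S : Set W) : Prop where
  disjoint : Disjoint T S
  adj_iff : ∀ u v, G.Adj u v ↔ u ≠ v ∧ ((u ∈ T ∧ v ∈ T) ∨ (u ∈ T ∧ v ∈ S) ∨ (u ∈ S ∧ v ∈ T))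

open Classical in
-- Up to the diagonal correction `χ T`, the adjacency matrix is a product `P * R` of rank at most 2,
-- so det(1 - UV) = det(1 - VU) reduces the determinant to size 2. The factor x(x+1) clears
-- denominators.
theorem IsCompleteSplitOn.charpoly_eval [Fintype W] {G : SimpleGraph W} {T S : Set W}
    (h : G.IsCompleteSplitOn T S) {x : ℝ} (hx : x ≠ 0) (hx1 : x + 1 ≠ 0) :
    x * (x + 1) * (G.adjMatrix ℝ).charpoly.eval x =
      (x + 1) ^ T.ncard * x ^ (Fintype.card W - T.ncard) *
        (x ^ 2 - (T.ncard - 1) * x - T.ncard * S.ncard) := by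
  set χ : Set W → W → ℝ := fun U v => if v ∈ U then 1 else 0 with hχ
  have hsum : ∀ U : Set W, ∑ v, χ U v = U.ncard := by
    intro U
    rw [Set.ncard_eq_toFinset_card', ← Set.filter_mem_univ_eq_toFinset]
    simp [hχ]
  set d : W → ℝ := fun v => if v ∈ T then x + 1 else x with hd
  have hd0 : ∀ v, d v ≠ 0 := by intro v; simp only [hd]; split_ifs <;> assumption
  set P : Matrix W (Fin 2) ℝ := of fun v => ![χ T v, χ S v] with hP
  set R : Matrix (Fin 2) W ℝ := of ![fun v => χ T v + χ S v, fun v => χ T v] with hR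
  have hM : scalar W x - G.adjMatrix ℝ =
      diagonal d * (1 - (diagonal fun v => (d v)⁻¹) * P * R) := by
    rw [Matrix.mul_sub, ← Matrix.mul_assoc, ← Matrix.mul_assoc, diagonal_mul_diagonal]
    simp only [mul_inv_cancel₀ (hd0 _), diagonal_one, Matrix.mul_one, Matrix.one_mul]
    ext u v
    have hdis : ∀ w, w ∈ T → w ∉ S := fun w h1 h2 => Set.disjoint_left.1 h.disjoint h1 h2
    simp only [Matrix.sub_apply, scalar_apply, adjMatrix_apply, h.adj_iff, mul_apply, Fin.sum_univ_two,
      hP, hR, of_apply, cons_val_zero, cons_val_one, hχ, hd, diagonal_apply]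
    by_cases huv : u = v
    · subst huv
      by_cases hT : u ∈ T
      · simp [hT, hdis u hT]
      · simp [hT]
    · by_cases h1 : u ∈ T <;> by_cases h2 : v ∈ T <;> by_cases h3 : u ∈ S <;>
        by_cases h4 : v ∈ S <;> simp_all
  have hsmall : R * ((diagonal fun v => (d v)⁻¹) * P) =
      !![(T.ncard : ℝ) / (x + 1), S.ncard / x; T.ncard / (x + 1), 0] := by
    have hdis : ∀ w, w ∈ T → w ∉ S := fun w h1 h2 => Set.disjoint_left.1 h.disjoint h1 h2
    have e : ∀ i j, (R * ((diagonal fun v => (d v)⁻¹) * P)) i j =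
        ∑ v, R i v * ((d v)⁻¹ * P v j) := by
      intro i j; simp [mul_apply, diagonal_apply]
    ext i j
    rw [e]
    fin_cases i <;> fin_cases j <;>
      simp only [hP, hR, of_apply, cons_val_zero, cons_val_one, Fin.zero_eta, Fin.mk_one,
        Fin.isValue]
    · rw [div_eq_mul_inv, ← hsum, Finset.sum_mul]
      refine Finset.sum_congr rfl fun v _ => ?_
      by_cases hT : v ∈ T <;> simp [hχ, hd, hT, hdis v]
    · rw [div_eq_mul_inv, ← hsum, Finset.sum_mul]
      refine Finset.sum_congr rfl fun v _ => ?_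
      by_cases hT : v ∈ T <;> by_cases hS : v ∈ S <;> 
        simp [hχ, hd, hT, hS]
      exact absurd hS (hdis v hT)
    · rw [div_eq_mul_inv, ← hsum, Finset.sum_mul]
      refine Finset.sum_congr rfl fun v _ => ?_
      by_cases hT : v ∈ T <;> simp [hχ, hd, hT]
    · refine Finset.sum_eq_zero fun v _ => ?_
      by_cases hT : v ∈ T <;> simp [hχ, hT, hdis v]
  have hprod : ∏ v, d v = (x + 1) ^ T.ncard * x ^ (Fintype.card W - T.ncard) := by
    simp only [hd]
    rw [Finset.prod_ite, Finset.prod_const, Finset.prod_const, Set.ncard_eq_toFinset_card',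
      ← Set.filter_mem_univ_eq_toFinset]
    congr 2
    rw [Finset.filter_not, Finset.card_sdiff_of_subset (Finset.filter_subset _ _),
      Finset.card_univ]
  rw [Matrix.eval_charpoly, hM, det_mul, det_diagonal, hprod, det_one_sub_mul_comm, hsmall,
    det_fin_two]
  simp
  field_simp
  ring

open Classical in
theorem IsCompleteSplitOn.charpoly_eq [Fintype W] {G : SimpleGraph W} {T S : Set W}
    (h : G.IsCompleteSplitOn T S) :
    X * (X + 1) * (G.adjMatrix ℝ).charpoly =
      (X + 1) ^ T.ncard * X ^ (Fintype.card W - T.ncard) *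
        (X ^ 2 - C ((T.ncard : ℝ) - 1) * X - C ((T.ncard : ℝ) * S.ncard)) := by
  refine Polynomial.eq_of_infinite_eval_eq _ _ (Set.Infinite.mono (s := Set.Ioi 0) ?_
    (Set.Ioi_infinite 0))
  intro x hx
  have hx : 0 < x := hx
  simpa using h.charpoly_eval hx.ne' (by positivity)

end SimpleGraph

/-! ### From eigenvalue conditions to the complete split structure -/

namespace SimpleGraph

variable {W : Type*} [Fintype W]

open Classical in
/-- The graph analogue of Lorentzian signature: the second largest adjacency eigenvalue is
nonpositive. -/
def HasLorentzianAdj (G : SimpleGraph W) : Prop :=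
  ∀ x y : W → ℝ, 0 < x ⬝ᵥ (G.adjMatrix ℝ *ᵥ x) →
    (x ⬝ᵥ (G.adjMatrix ℝ *ᵥ x)) * (y ⬝ᵥ (G.adjMatrix ℝ *ᵥ y)) ≤
      (x ⬝ᵥ (G.adjMatrix ℝ *ᵥ y)) ^ 2

open Classical in
theorem hasLorentzianAdj_of_countP_le [Nonempty W] (G : SimpleGraph W)
    (h : (G.adjMatrix ℝ).charpoly.roots.countP (0 < ·) ≤ 1) : G.HasLorentzianAdj := by
  have hA : (G.adjMatrix ℝ).IsHermitian := by
    ext i j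
    simp [adjMatrix_apply, adj_comm]
  obtain ⟨i₀, hi₀⟩ := hA.exists_forall_ne_not _ h
  have := hA.exists_dotProduct_eq_zero_imp i₀ 1 0 fun i hi => by
    simpa using hi₀ i hi
  intro x y hx
  refine (G.isSymm_adjMatrix).dotProduct_mulVec_mul_le ?_ x y hx
  simpa using this

open Classical in
-- The positive eigenvalues of -A - 1 come from the eigenvalues of A below -1.
theorem dotProduct_mulVec_mul_le_of_countP_le [Nonempty W] (G : SimpleGraph W)
    (h : (G.adjMatrix ℝ).charpoly.roots.countP (· < -1) ≤ 1) (x y : W → ℝ)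
    (hx : 0 < x ⬝ᵥ ((-(G.adjMatrix ℝ) - 1) *ᵥ x)) :
    (x ⬝ᵥ ((-(G.adjMatrix ℝ) - 1) *ᵥ x)) * (y ⬝ᵥ ((-(G.adjMatrix ℝ) - 1) *ᵥ y)) ≤
      (x ⬝ᵥ ((-(G.adjMatrix ℝ) - 1) *ᵥ y)) ^ 2 := by
  have hA : (G.adjMatrix ℝ).IsHermitian := by
    ext i j
    simp [adjMatrix_apply, adj_comm]
  obtain ⟨i₀, hi₀⟩ := hA.exists_forall_ne_not _ h
  have := hA.exists_dotProduct_eq_zero_imp i₀ (-1) (-1) fun i hi => by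
    have := hi₀ i hi
    linarith
  refine IsSymm.dotProduct_mulVec_mul_le ?_ ?_ x y hx
  · exact (G.isSymm_adjMatrix).neg.sub isSymm_one
  · simpa [sub_eq_add_neg] using this

/-- In a graph with one positive eigenvalue, nonadjacency is transitive through a nonisolated
vertex. -/
theorem HasLorentzianAdj.not_adj_trans {G : SimpleGraph W} (h : G.HasLorentzianAdj)
    {x y z w : W} (hyw : G.Adj y w) (hxy : ¬ G.Adj x y) (hyz : ¬ G.Adj y z) : ¬ G.Adj x z := by
  classical
  intro hxz
  have hzy : ¬ G.Adj z y := fun h => hyz h.symm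
  by_cases hxw : G.Adj x w <;> by_cases hzw : G.Adj z w
  · have := h (Pi.single x 1 + Pi.single z 1 + Pi.single w 1)
      ((2 : ℝ) • Pi.single y 1 + Pi.single w 1)
    simp [mulVec_add, add_dotProduct, dotProduct_add, mulVec_smul, adjMatrix_apply, hyw, hxy,
      hzy, hxz, hxw, hzw, hyw.symm, hxz.symm, hxw.symm, hzw.symm] at this
    norm_num at this
  all_goals
    -- Edges xz and yw with at most one edge between them: 2 · 2 ≤ 1 would follow.
    have := h (Pi.single x 1 + Pi.single z 1) (Pi.single y 1 + Pi.single w 1)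
    simp [mulVec_add, add_dotProduct, dotProduct_add, adjMatrix_apply, hyw, hxy,
      hzy, hxz, hxw, hzw, hyw.symm, hxz.symm] at this
    norm_num at this

/-- The nonisolated vertices adjacent to all other nonisolated vertices. -/
def dominatingSet (G : SimpleGraph W) : Set W :=
  {v | v ∈ G.support ∧ ∀ w ∈ G.support, w ≠ v → G.Adj v w}

/-- If `-1` is an eigenvalue of a complete multipartite graph (up to isolated vertices), then some
part is a singleton. -/
theorem dominatingSet_nonempty {G : SimpleGraph W}
    (htrans : ∀ x y z w, G.Adj y w → ¬ G.Adj x y → ¬ G.Adj y z → ¬ G.Adj x z)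
    {f : W → ℝ} (hf : f ≠ 0)
    (hfe : ∀ v, ∑ w, (open Classical in if G.Adj v w then f w else 0) = -f v) :
    G.dominatingSet.Nonempty := by
  classical
  by_contra hempty
  rw [Set.not_nonempty_iff_eq_empty] at hempty
  have hiso : ∀ v, v ∉ G.support → f v = 0 := by
    intro v hv
    have := hfe v
    rw [Finset.sum_eq_zero] at this
    · linarith
    · intro w _
      rw [if_neg]
      exact fun h => hv ⟨w, h⟩
  -- For nonisolated v, `N v` is the part containing v, and v itself is counted.
  set N : W → Finset W := fun v => Finset.univ.filter fun w => w ∈ G.support ∧ ¬ G.Adj v w with hN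
  set s := ∑ w, f w with hs
  have hnbr : ∀ v ∈ G.support, ∀ w ∈ N v, ∀ z, G.Adj v z ↔ G.Adj w z := by
    rintro v ⟨a, hva⟩ w hw z
    obtain ⟨⟨b, hwb⟩, hvw⟩ : w ∈ G.support ∧ ¬ G.Adj v w := by simpa [hN] using hw
    constructor
    · intro h1
      by_contra h2
      exact htrans v w z b hwb hvw h2 h1
    · intro h1
      by_contra h2
      exact htrans w v z a hva (fun h => hvw h.symm) h2 h1
  have hconst : ∀ v ∈ G.support, ∀ w ∈ N v, f w = f v := by
    intro v hv w hw
    have h1 := hfe v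
    have h2 := hfe w
    simp only [hnbr v hv w hw] at h1
    linarith
  have hsplit : ∀ v ∈ G.support, s = f v * ((N v).card - 1) := by
    intro v hv
    have h1 := hfe v
    have h2 : s = ∑ w, (if G.Adj v w then f w else 0) + ∑ w ∈ N v, f w := by
      rw [hs, hN, Finset.sum_filter, ← Finset.sum_add_distrib]
      refine Finset.sum_congr rfl fun w _ => ?_
      by_cases hw : w ∈ G.support <;> by_cases hvw : G.Adj v w <;> simp [hw, hvw, hiso]
    rw [h2, h1, Finset.sum_congr rfl (hconst v hv), Finset.sum_const, nsmul_eq_mul]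
    ring
  have hcard : ∀ v ∈ G.support, 2 ≤ (N v).card := by
    intro v hv
    have hvd : v ∉ G.dominatingSet := by simp [hempty]
    have : ∃ w ∈ G.support, w ≠ v ∧ ¬ G.Adj v w := by
      by_contra hcon
      push Not at hcon
      exact hvd ⟨hv, hcon⟩
    obtain ⟨w, hw, hwv, hvw⟩ := this
    exact Finset.one_lt_card.2 ⟨w, by simp [hN, hw, hvw], v, by simp [hN, hv], hwv⟩
  have hcard' : ∀ v ∈ G.support, (0 : ℝ) < (N v).card - 1 := by
    intro v hv
    have : (2 : ℝ) ≤ (N v).card := by exact_mod_cast hcard v hv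
    linarith
  obtain ⟨v₀, hv₀⟩ := Function.ne_iff.1 hf
  have hv₀s : v₀ ∈ G.support := by
    by_contra h
    exact hv₀ (hiso v₀ h)
  have hfv₀ : f v₀ ≠ 0 := hv₀
  have hs0 : s * f v₀ > 0 := by
    rw [hsplit v₀ hv₀s]
    have := hcard' v₀ hv₀s
    have h2 : 0 < f v₀ * f v₀ := mul_self_pos.2 hfv₀
    nlinarith
  have hsame : ∀ v, 0 ≤ s * f v := by
    intro v
    by_cases hv : v ∈ G.support
    · rw [hsplit v hv]
      nlinarith [hcard' v hv, mul_self_nonneg (f v)]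
    · simp [hiso v hv]
  -- All terms s · f(w) are nonnegative, so the part of v₀ gives |N v₀| · s f(v₀) ≤ s², whereas
  -- `hsplit` gives s² = (|N v₀| - 1) · s f(v₀).
  have h1 : ∑ w ∈ N v₀, s * f w ≤ ∑ w, s * f w :=
    Finset.sum_le_sum_of_subset_of_nonneg (Finset.subset_univ _) fun w _ _ => hsame w
  rw [← Finset.mul_sum, ← Finset.mul_sum, Finset.sum_congr rfl (hconst v₀ hv₀s), Finset.sum_const,
    nsmul_eq_mul, ← hs] at h1
  have h3 : s * s = s * (f v₀ * ((N v₀).card - 1)) := by rw [← hsplit v₀ hv₀s]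
  nlinarith

open Classical in
/-- Two nonsingleton parts next to a singleton part yield two eigenvalues less than `-1`. -/
theorem not_countP_le_one_of_octahedral {G : SimpleGraph W} {a a' b b' t : W} (haa : a ≠ a')
    (hbb : b ≠ b') (naa : ¬ G.Adj a a') (nbb : ¬ G.Adj b b') (hab : G.Adj a b)
    (hab' : G.Adj a b') (ha'b : G.Adj a' b) (ha'b' : G.Adj a' b') (hta : G.Adj t a)
    (hta' : G.Adj t a') (htb : G.Adj t b) (htb' : G.Adj t b') :
    ¬ (G.adjMatrix ℝ).charpoly.roots.countP (· < -1) ≤ 1 := by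
  intro h
  have : Nonempty W := ⟨a⟩
  -- Both vectors have value 4 under -A - 1 and their cross term vanishes, so 16 ≤ 0.
  have := G.dotProduct_mulVec_mul_le_of_countP_le h
    (Pi.single a 1 + Pi.single a' 1 - Pi.single b 1 - Pi.single b' 1)
    (Pi.single a 1 + Pi.single a' 1 + Pi.single b 1 + Pi.single b' 1 - (4 : ℝ) • Pi.single t 1)
  have naa' : ¬ G.Adj a' a := fun h => naa h.symm
  have nbb' : ¬ G.Adj b' b := fun h => nbb h.symm
  simp [mulVec_add, mulVec_sub, add_dotProduct, dotProduct_add, sub_dotProduct, dotProduct_sub,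
    mulVec_smul, adjMatrix_apply, naa, naa', nbb, nbb', hab, hab', ha'b, ha'b',
    hta, hta', htb, htb', hab.symm, hab'.symm, ha'b.symm, ha'b'.symm, hta.symm, hta'.symm,
    htb.symm, htb'.symm, haa, haa.symm, hbb, hbb.symm, hab.ne, hab.ne', hab'.ne, hab'.ne',
    ha'b.ne, ha'b.ne', ha'b'.ne, ha'b'.ne', hta.ne, hta.ne', hta'.ne, hta'.ne', htb.ne, htb.ne',
    htb'.ne, htb'.ne'] at this
  norm_num at this

open Classical in
-- An edge ab outside the dominating set would join two parts of size at least 2; with a dominating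
-- vertex t these form the configuration excluded by `not_countP_le_one_of_octahedral`.
theorem isCompleteSplitOn_dominatingSet {G : SimpleGraph W}
    (htrans : ∀ x y z w, G.Adj y w → ¬ G.Adj x y → ¬ G.Adj y z → ¬ G.Adj x z)
    (hne : G.dominatingSet.Nonempty)
    (hcount : (G.adjMatrix ℝ).charpoly.roots.countP (· < -1) ≤ 1) :
    G.IsCompleteSplitOn G.dominatingSet (G.support \ G.dominatingSet) := by
  have hpartner : ∀ a ∈ G.support \ G.dominatingSet, ∃ a' ∈ G.support, a ≠ a' ∧ ¬ G.Adj a a' := by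
    rintro a ⟨ha, hnd⟩
    by_contra hcon
    push Not at hcon
    exact hnd ⟨ha, fun w hw hwa => hcon w hw hwa.symm⟩
  have hindep : ∀ a ∈ G.support \ G.dominatingSet, ∀ b ∈ G.support \ G.dominatingSet,
      ¬ G.Adj a b := by
    intro a ha b hb hab
    obtain ⟨a', ha', haa, naa⟩ := hpartner a ha
    obtain ⟨b', hb', hbb, nbb⟩ := hpartner b hb
    obtain ⟨t, ht⟩ := hne
    have htadj : ∀ x ∈ G.support, ∀ y ∈ G.support, x ≠ y → ¬ G.Adj x y → G.Adj t x := by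
      intro x hx y hy hxy hnxy
      refine ht.2 x hx ?_
      rintro rfl
      exact hnxy (ht.2 y hy hxy.symm)
    have ha'b : G.Adj a' b := by
      by_contra hcon
      obtain ⟨w, hw⟩ := ha'
      exact htrans a a' b w hw naa hcon hab
    have hab' : G.Adj a b' := by
      by_contra hcon
      obtain ⟨w, hw⟩ := hb'
      exact htrans a b' b w hw hcon (fun h => nbb h.symm) hab
    have ha'b' : G.Adj a' b' := by
      by_contra hcon
      obtain ⟨w, hw⟩ := hb'
      exact htrans a' b' b w hw hcon (fun h => nbb h.symm) ha'b
    exact not_countP_le_one_of_octahedral haa hbb naa nbb hab hab' ha'b ha'b'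
      (htadj a ha.1 a' ha' haa naa) (htadj a' ha' a ha.1 haa.symm fun h => naa h.symm)
      (htadj b hb.1 b' hb' hbb nbb) (htadj b' hb' b hb.1 hbb.symm fun h => nbb h.symm) hcount
  refine ⟨Set.disjoint_sdiff_right, fun u v => ⟨fun h => ⟨h.ne, ?_⟩, ?_⟩⟩
  · have hu : u ∈ G.support := ⟨v, h⟩
    have hv : v ∈ G.support := ⟨u, h.symm⟩
    by_cases h1 : u ∈ G.dominatingSet <;> by_cases h2 : v ∈ G.dominatingSet
    · exact Or.inl ⟨h1, h2⟩
    · exact Or.inr (Or.inl ⟨h1, hv, h2⟩)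
    · exact Or.inr (Or.inr ⟨⟨hu, h1⟩, h2⟩)
    · exact absurd h (hindep u ⟨hu, h1⟩ v ⟨hv, h2⟩)
  · rintro ⟨huv, ⟨h1, h2⟩ | ⟨h1, h2⟩ | ⟨h1, h2⟩⟩
    · exact h1.2 v h2.1 huv.symm
    · exact h1.2 v h2.1 huv.symm
    · exact (h2.2 u h1.1 huv).symm

end SimpleGraph

/-! ### Spectrum, parameters and isomorphism of complete split graphs -/

namespace SimpleGraph

variable {V W : Type*} [Fintype V] [Fintype W]

open Classical in
/-- The nontrivial factor of the characteristic polynomial of a complete split graph has a positive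
and a negative root. -/
theorem IsCompleteSplitOn.exists_charpoly_eq {G : SimpleGraph W} {T S : Set W}
    (h : G.IsCompleteSplitOn T S) (hT : T.Nonempty) (hS : S.Nonempty) :
    ∃ a b : ℝ, 0 < a ∧ b < 0 ∧ a + b = T.ncard - 1 ∧ a * b = -(T.ncard * S.ncard) ∧
      X * (X - C (-1)) * (G.adjMatrix ℝ).charpoly =
        (X - C (-1)) ^ T.ncard * X ^ (Fintype.card W - T.ncard) * ((X - C a) * (X - C b)) := by
  have ht : (0 : ℝ) < T.ncard := by exact_mod_cast (Set.ncard_pos).2 hT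
  have hs : (0 : ℝ) < S.ncard := by exact_mod_cast (Set.ncard_pos).2 hS
  have hmul : (0 : ℝ) < T.ncard * S.ncard := mul_pos ht hs
  have hr := Real.sq_sqrt (show (0 : ℝ) ≤ (T.ncard - 1) ^ 2 + 4 * (T.ncard * S.ncard) by positivity)
  have hr0 := Real.sqrt_nonneg ((T.ncard - 1 : ℝ) ^ 2 + 4 * (T.ncard * S.ncard))
  set r := Real.sqrt ((T.ncard - 1 : ℝ) ^ 2 + 4 * (T.ncard * S.ncard))
  have habs : |(T.ncard : ℝ) - 1| < r := by
    rw [← abs_of_nonneg hr0]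
    exact sq_lt_sq.1 (by linarith)
  rw [abs_lt] at habs
  have hsum : ((T.ncard - 1 : ℝ) + r) / 2 + ((T.ncard - 1 : ℝ) - r) / 2 = T.ncard - 1 := by ring
  have hprod : ((T.ncard - 1 : ℝ) + r) / 2 * (((T.ncard - 1 : ℝ) - r) / 2) =
      -(T.ncard * S.ncard) := by nlinarith
  refine ⟨((T.ncard - 1 : ℝ) + r) / 2, ((T.ncard - 1 : ℝ) - r) / 2, by linarith, by linarith,
    hsum, hprod, ?_⟩
  have e := h.charpoly_eq
  rw [← hsum, ← neg_eq_iff_eq_neg.2 hprod] at e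
  simp only [C_neg, C_1, sub_neg_eq_add]
  rw [e]
  simp only [C_neg, C_add, C_mul]
  ring

open Classical in
-- The added 0 and -1 avoid subtracting 1 from the multiplicities.
theorem IsCompleteSplitOn.exists_roots_eq {G : SimpleGraph W} {T S : Set W}
    (h : G.IsCompleteSplitOn T S) (hT : T.Nonempty) (hS : S.Nonempty) :
    ∃ a b : ℝ, 0 < a ∧ b < 0 ∧ a + b = T.ncard - 1 ∧ a * b = -(T.ncard * S.ncard) ∧
      {0} + {-1} + (G.adjMatrix ℝ).charpoly.roots =
        Multiset.replicate T.ncard (-1) + Multiset.replicate (Fintype.card W - T.ncard) 0 +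
          ({a} + {b}) := by
  obtain ⟨a, b, ha, hb, hab, hab', e⟩ := h.exists_charpoly_eq hT hS
  refine ⟨a, b, ha, hb, hab, hab', ?_⟩
  have hχ : (G.adjMatrix ℝ).charpoly ≠ 0 := (charpoly_monic _).ne_zero
  have e' := congrArg roots e
  have hX : ∀ c : ℝ, (X - C c) ≠ 0 := X_sub_C_ne_zero
  rw [roots_mul (mul_ne_zero (mul_ne_zero X_ne_zero (hX _)) hχ),
    roots_mul (mul_ne_zero X_ne_zero (hX _)),
    roots_mul (mul_ne_zero (mul_ne_zero (pow_ne_zero _ (hX _)) (pow_ne_zero _ X_ne_zero))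
      (mul_ne_zero (hX _) (hX _))),
    roots_mul (mul_ne_zero (pow_ne_zero _ (hX _)) (pow_ne_zero _ X_ne_zero)),
    roots_mul (mul_ne_zero (hX _) (hX _))] at e'
  simpa only [roots_X, roots_X_sub_C, roots_pow, Multiset.nsmul_singleton] using e'

/-- The sizes of the clique and of the independent set are determined by the spectrum. -/
theorem IsCompleteSplitOn.ncard_eq {G : SimpleGraph V} {G' : SimpleGraph W} {T S : Set V}
    {T' S' : Set W} (h : G.IsCompleteSplitOn T S) (h' : G'.IsCompleteSplitOn T' S')
    (hT : T.Nonempty) (hS : S.Nonempty) (hT' : T'.Nonempty) (hS' : S'.Nonempty)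
    (hcard : Fintype.card V = Fintype.card W) (hcosp : Cospectral G G') :
    T.ncard = T'.ncard ∧ S.ncard = S'.ncard := by
  obtain ⟨a, b, ha, hb, hab, hab', e⟩ := h.exists_roots_eq hT hS
  obtain ⟨a', b', ha', hb', hab₁, hab₁', e'⟩ := h'.exists_roots_eq hT' hS'
  have hroots := hcosp
  simp only [Cospectral, adjSpectrum] at hroots
  rw [hroots, e'] at e
  have hTV : T.ncard ≤ Fintype.card V := by
    rw [← Nat.card_eq_fintype_card]; exact Set.ncard_le_card T
  have hTW : T'.ncard ≤ Fintype.card W := by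
    rw [← Nat.card_eq_fintype_card]; exact Set.ncard_le_card T'
  -- The multiplicity of 0 gives t; cancelling leaves {a, b}, whose product -ts gives s.
  have hc := congrArg (Multiset.count 0) e
  simp [Multiset.count_replicate, ha.ne, hb.ne', ha'.ne, hb'.ne'] at hc
  have htt : T.ncard = T'.ncard := by omega
  refine ⟨htt, ?_⟩
  rw [htt, hcard] at e
  have e₁ := add_left_cancel e
  have e₂ := congrArg Multiset.prod e₁
  simp only [Multiset.prod_add, Multiset.prod_singleton, hab', hab₁', htt] at e₂
  have ht0 : (T'.ncard : ℝ) ≠ 0 := by exact_mod_cast ((Set.ncard_pos).2 hT').ne'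
  have : (S.ncard : ℝ) = S'.ncard := by
    have := neg_injective e₂
    exact (mul_left_cancel₀ ht0 this).symm
  exact_mod_cast this

open Classical in
theorem IsCompleteSplitOn.countP_roots_le {G : SimpleGraph W} {T S : Set W}
    (h : G.IsCompleteSplitOn T S) (hT : T.Nonempty) (hS : S.Nonempty) :
    (G.adjMatrix ℝ).charpoly.roots.countP (0 < ·) ≤ 1 ∧
      (G.adjMatrix ℝ).charpoly.roots.countP (· < -1) ≤ 1 := by
  obtain ⟨a, b, ha, hb, -, -, e⟩ := h.exists_roots_eq hT hS
  constructor
  · have hc := congrArg (Multiset.countP (0 < ·)) e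
    simp only [Multiset.countP_add, ← Multiset.nsmul_singleton, Multiset.countP_nsmul] at hc
    simp [← Multiset.cons_zero, ha, hb.le] at hc
    omega
  · have hc := congrArg (Multiset.countP (· < -1)) e
    simp only [Multiset.countP_add, ← Multiset.nsmul_singleton, Multiset.countP_nsmul] at hc
    have ha1 : ¬ a < -1 := by linarith
    simp [← Multiset.cons_zero, Multiset.countP_cons, ha1] at hc
    split_ifs at hc <;> omega

open Classical in
theorem IsCompleteSplitOn.neg_one_mem_roots {G : SimpleGraph W} {T S : Set W}
    (h : G.IsCompleteSplitOn T S) (hT : T.Nonempty) (hS : S.Nonempty)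
    (hor : 2 ≤ T.ncard ∨ S.ncard = 1) : -1 ∈ (G.adjMatrix ℝ).charpoly.roots := by
  obtain ⟨a, b, ha, hb, hab, hab', e⟩ := h.exists_roots_eq hT hS
  have hc := congrArg (Multiset.count (-1)) e
  have ha1 : (-1 : ℝ) ≠ a := by linarith
  have ht := (Set.ncard_pos).2 hT
  rw [← Multiset.count_pos]
  simp [-count_roots, Multiset.count_replicate, Multiset.count_singleton, ha1] at hc
  rcases hor with h2 | h1
  · split_ifs at hc <;> omega
  -- For s = 1, (a+1)(b+1) = -t + (t-1) + 1 = 0.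
  · have hb1 : -1 = b := by
      have ht' : (0 : ℝ) < T.ncard := by exact_mod_cast ht
      rw [h1] at hab'
      have : (b + 1) * (a + 1) = 0 := by push_cast at hab'; linarith
      rcases mul_eq_zero.1 this with h | h <;> linarith
    rw [if_pos hb1] at hc
    omega

/-- Complete split graphs with cliques and independent sets of equal sizes are isomorphic. -/
theorem IsCompleteSplitOn.nonempty_iso {G : SimpleGraph V} {G' : SimpleGraph W} {T S : Set V}
    {T' S' : Set W} (h : G.IsCompleteSplitOn T S) (h' : G'.IsCompleteSplitOn T' S')
    (hU : T ∪ S = Set.univ) (hcard : Fintype.card V = Fintype.card W)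
    (hT : T.ncard = T'.ncard) (hS : S.ncard = S'.ncard) : Nonempty (G ≃g G') := by
  classical
  have hV : T.ncard + S.ncard = Fintype.card V := by
    rw [← Set.ncard_union_eq h.disjoint, hU, Set.ncard_univ, Nat.card_eq_fintype_card]
  -- The sizes already exhaust the vertices, so `G'` has no isolated vertices outside the split.
  have hU' : T' ∪ S' = Set.univ := by
    refine Set.eq_of_subset_of_ncard_le (Set.subset_univ _) ?_
    rw [Set.ncard_univ, Set.ncard_union_eq h'.disjoint, Nat.card_eq_fintype_card]
    omega
  have hSc : S = Tᶜ :=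
    (IsCompl.of_eq (Set.disjoint_iff_inter_eq_empty.1 h.disjoint) hU).compl_eq.symm
  have hSc' : S' = T'ᶜ :=
    (IsCompl.of_eq (Set.disjoint_iff_inter_eq_empty.1 h'.disjoint) hU').compl_eq.symm
  subst hSc hSc'
  obtain ⟨eT⟩ : Nonempty (T ≃ T') := Finite.card_eq.1 hT
  obtain ⟨eS⟩ : Nonempty ((Tᶜ : Set V) ≃ (T'ᶜ : Set W)) := Finite.card_eq.1 hS
  set f : V ≃ W :=
    (Equiv.Set.sumCompl T).symm.trans ((Equiv.sumCongr eT eS).trans (Equiv.Set.sumCompl T')) with hf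
  have hfT : ∀ v, f v ∈ T' ↔ v ∈ T := by
    intro v
    by_cases hv : v ∈ T
    · simp [hf, hv, Equiv.Set.sumCompl_symm_apply_of_mem]
    · have hfv : f v = eS ⟨v, hv⟩ := by
        simp [hf, hv, Equiv.Set.sumCompl_symm_apply_of_notMem]
      rw [hfv]
      exact iff_of_false (eS ⟨v, hv⟩).2 hv
  refine ⟨f, fun {u v} => ?_⟩
  rw [h.adj_iff, h'.adj_iff]
  simp [hfT]

end SimpleGraph

/-! ### Spectral characterization and the main theorem -/

namespace SimpleGraph

variable {V W : Type*}

theorem card_adjSpectrum [Fintype W] (G : SimpleGraph W) : G.adjSpectrum.card = Fintype.card W := by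
  classical
  have hA : (G.adjMatrix ℝ).IsHermitian := by
    ext i j
    simp [adjMatrix_apply, adj_comm]
  have := congrArg Multiset.card hA.roots_charpoly_eq_eigenvalues
  simp only [Multiset.card_map, Finset.card_val, Finset.card_univ] at this
  rw [← this, adjSpectrum]

/-- A complete split structure with empty independent set may be given a singleton one. -/
theorem IsCompleteSplitOn.exists_nonempty {G : SimpleGraph W} {T S : Set W}
    (h : G.IsCompleteSplitOn T S) {u v : W} (huv : G.Adj u v) :
    ∃ T' S' : Set W, G.IsCompleteSplitOn T' S' ∧ T'.Nonempty ∧ S'.Nonempty := by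
  rcases S.eq_empty_or_nonempty with rfl | hS
  · have hT := (h.adj_iff u v).1 huv
    simp only [Set.mem_empty_iff_false, and_false, false_and, or_false] at hT
    obtain ⟨hne, hu, hv⟩ := hT
    refine ⟨T \ {v}, {v}, ⟨Set.disjoint_sdiff_left, fun x y => ?_⟩, ⟨u, hu, hne⟩,
      Set.singleton_nonempty v⟩
    rw [h.adj_iff]
    simp only [Set.mem_empty_iff_false, and_false, false_and, or_false, Set.mem_sdiff,
      Set.mem_singleton_iff]
    by_cases hx : x = v <;> by_cases hy : y = v <;> simp_all
  · refine ⟨T, S, h, ?_, hS⟩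
    rcases ((h.adj_iff u v).1 huv).2 with h | h | h
    exacts [⟨u, h.1⟩, ⟨u, h.1⟩, ⟨v, h.2⟩]

open Classical in
/-- A graph with one positive eigenvalue, at most one eigenvalue less than `-1`, and eigenvalue `-1`
is a complete split graph together with isolated vertices. -/
theorem exists_isCompleteSplitOn [Fintype W] {G : SimpleGraph W}
    (hpos : (G.adjMatrix ℝ).charpoly.roots.countP (0 < ·) ≤ 1)
    (hneg : (G.adjMatrix ℝ).charpoly.roots.countP (· < -1) ≤ 1)
    (hroot : -1 ∈ (G.adjMatrix ℝ).charpoly.roots) :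
    ∃ T S : Set W, G.IsCompleteSplitOn T S ∧ T.Nonempty ∧ S.Nonempty := by
  have hdet := isRoot_of_mem_roots hroot
  rw [IsRoot.def, Matrix.eval_charpoly] at hdet
  obtain ⟨f, hf, hfe⟩ := exists_mulVec_eq_zero_iff.2 hdet
  have hfe' : ∀ v, ∑ w, (if G.Adj v w then f w else 0) = -f v := by
    intro v
    have := congrFun hfe v
    rw [sub_mulVec, Pi.sub_apply, adjMatrix_mulVec_apply, neighborFinset_eq_filter,
      Finset.sum_filter, scalar_apply, mulVec_diagonal, Pi.zero_apply] at this
    linarith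
  obtain ⟨v₀, -⟩ := Function.ne_iff.1 hf
  have : Nonempty W := ⟨v₀⟩
  have htrans : ∀ x y z w, G.Adj y w → ¬ G.Adj x y → ¬ G.Adj y z → ¬ G.Adj x z :=
    fun _ _ _ _ => (G.hasLorentzianAdj_of_countP_le hpos).not_adj_trans
  have hne := dominatingSet_nonempty htrans hf hfe'
  obtain ⟨v, ⟨w, hvw⟩, -⟩ := id hne
  exact (isCompleteSplitOn_dominatingSet htrans hne hneg).exists_nonempty hvw

theorem IsCompleteSplitOn.isDeterminedBySpectrum [Fintype V] {G : SimpleGraph V} {T S : Set V}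
    (h : G.IsCompleteSplitOn T S) (hU : T ∪ S = Set.univ) (hT : T.Nonempty) (hS : S.Nonempty)
    (hor : 2 ≤ T.ncard ∨ S.ncard = 1) : IsDeterminedBySpectrum.{_, v} G := by
  intro W _ G' hcosp
  have hcard : Fintype.card V = Fintype.card W := by
    rw [← G.card_adjSpectrum, ← G'.card_adjSpectrum, hcosp]
  obtain ⟨hpos, hneg⟩ := h.countP_roots_le hT hS
  have hroot := h.neg_one_mem_roots hT hS hor
  have hroots := hcosp
  simp only [Cospectral, adjSpectrum] at hroots
  rw [← hroots] at hpos hneg hroot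
  obtain ⟨T', S', h', hT', hS'⟩ := exists_isCompleteSplitOn hpos hneg hroot
  obtain ⟨e₁, e₂⟩ := h.ncard_eq h' hT hS hT' hS' hcard hcosp.symm
  obtain ⟨f⟩ := h.nonempty_iso h' hU hcard e₁ e₂
  exact ⟨f.symm⟩

theorem deleteSubgraphEdges_completeGraph_adj {H : (completeGraph V).Subgraph} {m : ℕ}
    (e : H.coe ≃g completeGraph (Fin m)) (u v : V) :
    ((completeGraph V).deleteSubgraphEdges H).Adj u v ↔
      u ≠ v ∧ ¬ (u ∈ H.verts ∧ v ∈ H.verts) := by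
  rw [deleteSubgraphEdges, deleteEdges_adj, Subgraph.mem_edgeSet, top_adj]
  refine and_congr_right fun huv => not_congr ⟨fun h => ⟨h.fst_mem, h.snd_mem⟩, ?_⟩
  rintro ⟨hu, hv⟩
  have : H.coe.Adj ⟨u, hu⟩ ⟨v, hv⟩ := by
    rw [← e.map_adj_iff, top_adj]
    exact fun h => huv (congrArg Subtype.val (e.injective h))
  exact this

end SimpleGraph

theorem mainTheorem2 (n m : ℕ) (hmn : m + 2 ≤ n)
    (H : (SimpleGraph.completeGraph (Fin n)).Subgraph)
    (hH : Nonempty (H.coe ≃g SimpleGraph.completeGraph (Fin m))) :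
    SimpleGraph.IsDeterminedBySpectrum.{0, v}
      ((SimpleGraph.completeGraph (Fin n)).deleteSubgraphEdges H) := by
  obtain ⟨e⟩ := hH
  have hadj := SimpleGraph.deleteSubgraphEdges_completeGraph_adj e
  have hm : H.verts.ncard = m := by
    rw [← Nat.card_coe_set_eq, Nat.card_congr e.toEquiv, Nat.card_fin]
  obtain ⟨S, hS, hSn, hSadj⟩ : ∃ S : Set (Fin n), S.Nonempty ∧ (S.ncard + 2 ≤ n ∨ S.ncard = 1) ∧
      ∀ u v, u ≠ v → (u ∈ S ∧ v ∈ S ↔ u ∈ H.verts ∧ v ∈ H.verts) := by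
    rcases H.verts.eq_empty_or_nonempty with h0 | hne
    -- For m = 0 the graph is K_n, with any single vertex serving as independent set; for n = 2 the
    -- clique then has only one vertex, hence the alternative `S.ncard = 1`.
    · refine ⟨{⟨0, by omega⟩}, Set.singleton_nonempty _, Or.inr (Set.ncard_singleton _), ?_⟩
      intro u v huv
      simp only [h0, Set.mem_singleton_iff, Set.mem_empty_iff_false, and_self, iff_false]
      rintro ⟨rfl, rfl⟩
      exact huv rfl
    · exact ⟨H.verts, hne, Or.inl (by omega), fun _ _ _ => Iff.rfl⟩
  have hcard : Sᶜ.ncard + S.ncard = n := by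
    rw [add_comm, Set.ncard_add_ncard_compl, Nat.card_fin]
  refine SimpleGraph.IsCompleteSplitOn.isDeterminedBySpectrum (T := Sᶜ) (S := S)
    ⟨disjoint_compl_left, fun u v => ?_⟩ (Set.compl_union_self S) ?_ hS (by omega)
  · rw [hadj]
    refine and_congr_right fun huv => ?_
    rw [← hSadj u v huv]
    simp only [Set.mem_compl_iff]
    tauto
  · exact (Set.ncard_pos).1 (by omega)
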